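/- Let $M$ be a compact smooth manifold without boundary with a cosymplectic structure $(\eta,\omega)$: $\eta$ is a closed smooth $1$-form, $\omega$ a closed smooth $2$-form, $\eta$ vanishes nowhere, and at each point of $M$ the map $I_{\eta,\omega}\colon Y\mapsto \iota(Y)\omega+\eta(Y)\eta$ from tangent vectors to covectors is bijective. An isotopy of $M$ is a smooth path $\Phi=\{\phi_t\}_{0\le t\le 1}$ of diffeomorphisms with $\phi_0=\mathrm{id}$; $\dot\phi_t$ denotes the vector field with $\dot\phi_t(\phi_t(x))=\frac{d}{dt}\phi_t(x)$. The isotopy is *cosymplectic* if $\phi_t^*\eta=\eta$ and $\phi_t^*\omega=\omega$ for all $t$. It is *co-Hamiltonian* if it is cosymplectic and for each $t$ the vector field $\dot\phi_t$ satisfies $\mathcal L_{\dot\phi_t}\eta=0$, $\mathcal L_{\dot\phi_t}\omega=0$ and $I_{\eta,\omega}(\dot\phi_t)=dF_t$ for some smooth function $F_t$ on $M$. Let $\tilde M=M\times\mathbb S^1$ with projections $p\colon\tilde M\to M$ and $\pi_2\colon\tilde M\to\mathbb S^1$, where $\mathbb S^1=\mathbb R/2\pi\mathbb Z$ has angular form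 $d\theta$, and let $\tilde\omega=p^*\omega+p^*\eta\wedge\pi_2^*d\theta$. An isotopy $\{\psi_t\}$ of $\tilde M$ is *symplectic* if $\psi_t^*\tilde\omega=\tilde\omega$ for all $t$, and *Hamiltonian* if moreover $\iota(\dot\psi_t)\tilde\omega$ is the differential of a smooth function on $\tilde M$ for each $t$. Let $\Phi=\{\phi_t\}$ be an isotopy of $M$ and define, for $0\le t\le 1$, $$\tilde\phi_t\colon\tilde M\to\tilde M,\qquad \tilde\phi_t(x,\theta)=\Bigl(\phi_t(x),\ \theta-\int_0^t \eta(\dot\phi_s)\bigl(\phi_s(x)\bigr)\,ds \bmod 2\pi\Bigr).$$ 1. If $\{\phi_t\}$ is co-Hamiltonian (resp. cosymplectic), then $\{\tilde\phi_t\}$ is a Hamiltonian (resp. symplectic) isotopy of $(\tilde M,\tilde\omega)$. 2. Conversely, if $\{\tilde\phi_t\}$ is a Hamiltonian (resp. symplectic) isotopy of $(\tilde M,\tilde\omega)$, then $\{\phi_t\}$ is a co-Hamiltonian (resp. cosymplectic) isotopy of $(M,\eta,\omega)$. -/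

import Mathlib

open Set
open scoped Manifold ContDiff Bundle

noncomputable section

namespace Cosymplectic

section Forms

variable {E : Type*} [NormedAddCommGroup E] [NormedSpace ℝ E]
  {H : Type*} [TopologicalSpace H] (I : ModelWithCorners ℝ E H)
  (M : Type*) [TopologicalSpace M] [ChartedSpace H M]

/-- A (not necessarily continuous) field of covectors on `M`. -/
abbrev OneForm := ∀ x : M, TangentSpace I x →L[ℝ] ℝ

/-- A (not necessarily continuous or antisymmetric) field of bilinear forms on `M`. -/
abbrev TwoForm := ∀ x : M, TangentSpace I x →L[ℝ] TangentSpace I x →L[ℝ] ℝ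

/-- A (not necessarily continuous) vector field on `M`. -/
abbrev VField := ∀ x : M, TangentSpace I x

variable {M}

/-- `X` is a smooth section of the tangent bundle. -/
def VField.Smooth [IsManifold I ∞ M] (X : VField I M) : Prop :=
  ContMDiff I I.tangent ∞ (fun x ↦ (⟨x, X x⟩ : TangentBundle I M))

/-- `α` is a smooth section of the cotangent bundle. -/
def OneForm.Smooth [IsManifold I ∞ M] (α : OneForm I M) : Prop :=
  ContMDiff I (I.prod 𝓘(ℝ, E →L[ℝ] ℝ)) ∞
    (fun x ↦ Bundle.TotalSpace.mk' (E →L[ℝ] ℝ)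
      (E := fun x : M ↦ TangentSpace I x →L[ℝ] Bundle.Trivial M ℝ x) x (α x))

/-- `β` is a smooth section of the bundle of bilinear forms on the tangent spaces. -/
def TwoForm.Smooth [IsManifold I ∞ M] (β : TwoForm I M) : Prop :=
  ContMDiff I (I.prod 𝓘(ℝ, E →L[ℝ] E →L[ℝ] ℝ)) ∞
    (fun x ↦ Bundle.TotalSpace.mk' (E →L[ℝ] E →L[ℝ] ℝ)
      (E := fun x : M ↦ TangentSpace I x →L[ℝ] TangentSpace I x →L[ℝ] Bundle.Trivial M ℝ x)
      x (β x))

/-- The pull-back of the one-form `α` to the model space `E` under the inverse of the chart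
around `x₀`, i.e. the expression of `α` in the coordinates around `x₀`. -/
def OneForm.inChart (α : OneForm I M) (x₀ : M) (y : E) : E →L[ℝ] ℝ :=
  (α ((extChartAt I x₀).symm y)).comp
    (mfderivWithin 𝓘(ℝ, E) I (extChartAt I x₀).symm (range I) y)

/-- The pull-back of the two-form `β` to the model space `E` under the inverse of the chart
around `x₀`, i.e. the expression of `β` in the coordinates around `x₀`. -/
def TwoForm.inChart (β : TwoForm I M) (x₀ : M) (y : E) : E →L[ℝ] E →L[ℝ] ℝ :=
  let A := mfderivWithin 𝓘(ℝ, E) I (extChartAt I x₀).symm (range I) y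
  (ContinuousLinearMap.precomp ℝ A).comp ((β ((extChartAt I x₀).symm y)).comp A)

/-- The exterior derivative of a one-form, `dα(u, v) = (D_u α)(v) - (D_v α)(u)`, computed at `x`
in the preferred chart around `x`, through which Mathlib identifies `TangentSpace I x`
with `E`. -/
def OneForm.extDeriv (α : OneForm I M) (x : M) (u v : TangentSpace I x) : ℝ :=
  let D := fderivWithin ℝ (α.inChart I x) (range I) (extChartAt I x x)
  D u v - D v u

/-- The exterior derivative of a two-form,
`dβ(u, v, w) = (D_u β)(v, w) - (D_v β)(u, w) + (D_w β)(u, v)`, computed at `x`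
in the preferred chart around `x`, through which Mathlib identifies `TangentSpace I x`
with `E`. -/
def TwoForm.extDeriv (β : TwoForm I M) (x : M) (u v w : TangentSpace I x) : ℝ :=
  let D := fderivWithin ℝ (β.inChart I x) (range I) (extChartAt I x x)
  D u v w - D v u w + D w u v

/-- The differential of a function. -/
def differential (F : M → ℝ) : OneForm I M := fun x ↦ mfderiv I 𝓘(ℝ, ℝ) F x

/-- `α` is exact: it is the differential of a smooth function. -/
def OneForm.Exact (α : OneForm I M) : Prop :=
  ∃ F : M → ℝ, ContMDiff I 𝓘(ℝ, ℝ) ∞ F ∧ α = differential I F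

/-- The contraction `ι(X)β = β(X, ·)`. -/
def contract (X : VField I M) (β : TwoForm I M) : OneForm I M := fun x ↦ β x (X x)

/-- The Lie derivative of a one-form, by Cartan's formula `L_X α = ι(X) dα + d(α(X))`. -/
def OneForm.lieDeriv (X : VField I M) (α : OneForm I M) (x : M) (u : TangentSpace I x) : ℝ :=
  α.extDeriv I x (X x) u + differential I (fun y ↦ α y (X y)) x u

/-- The Lie derivative of a two-form, by Cartan's formula `L_X β = ι(X) dβ + d(ι(X)β)`. -/
def TwoForm.lieDeriv (X : VField I M) (β : TwoForm I M) (x : M) (u v : TangentSpace I x) : ℝ :=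
  β.extDeriv I x (X x) u v + (contract I X β).extDeriv I x u v

/-- `f^* α = α` for a one-form `α`. -/
def OneForm.PreservedBy (α : OneForm I M) (f : M → M) : Prop :=
  ∀ x (u : TangentSpace I x), α (f x) (mfderiv I I f x u) = α x u

/-- `f^* β = β` for a two-form `β`. -/
def TwoForm.PreservedBy (β : TwoForm I M) (f : M → M) : Prop :=
  ∀ x (u v : TangentSpace I x),
    β (f x) (mfderiv I I f x u) (mfderiv I I f x v) = β x u v

end Forms

section Isotopies

variable {E : Type*} [NormedAddCommGroup E] [NormedSpace ℝ E]
  {H : Type*} [TopologicalSpace H] (I : ModelWithCorners ℝ E H)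
  {M : Type*} [TopologicalSpace M] [ChartedSpace H M]

/-- `(φ t)`, `0 ≤ t ≤ 1`, is a smooth isotopy of `M`: a path of diffeomorphisms starting at the
identity and smooth on `[0, 1] × M`. Values of `φ` at times outside `[0, 1]` play no role. -/
structure IsIsotopy (φ : ℝ → M → M) : Prop where
  smooth : ContMDiffOn (𝓘(ℝ, ℝ).prod I) I ∞ (fun p : ℝ × M ↦ φ p.1 p.2) (Icc 0 1 ×ˢ univ)
  diffeo : ∀ t ∈ Icc (0 : ℝ) 1, ∃ f : Diffeomorph I I M M ∞, ∀ x, f x = φ t x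
  zero : ∀ x, φ 0 x = x

/-- The velocity at time `t` of the trajectory `s ↦ φ s x`, a tangent vector at `φ t x`. -/
def velocity (φ : ℝ → M → M) (t : ℝ) (x : M) : TangentSpace I (φ t x) :=
  mfderivWithin 𝓘(ℝ, ℝ) I (fun s ↦ φ s x) (Icc 0 1) t (1 : ℝ)

/-- `X` is the vector field generating the isotopy `φ` at time `t`: the field with
`X (φ t x) = d/dt (φ t x)` for all `x`. It is unique as `φ t` is onto. -/
def IsGeneratorAt (φ : ℝ → M → M) (t : ℝ) (X : VField I M) : Prop :=
  ∀ x, X (φ t x) = velocity I φ t x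

variable [IsManifold I ∞ M]

/-- Hamiltonian vector field of a symplectic form `σ`: the form `ι(X)σ` is exact. -/
structure IsHamiltonianField (σ : TwoForm I M) (X : VField I M) : Prop where
  smooth : X.Smooth I
  exact : (contract I X σ).Exact I

/-- Isotopy through symplectic diffeomorphisms of a symplectic form `σ`. -/
structure IsSymplecticIsotopy (σ : TwoForm I M) (φ : ℝ → M → M) : Prop where
  isotopy : IsIsotopy I φ
  preserves : ∀ t ∈ Icc (0 : ℝ) 1, σ.PreservedBy I (φ t)

/-- Symplectic isotopy that is generated at each time by a Hamiltonian vector field. -/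
structure IsHamiltonianIsotopy (σ : TwoForm I M) (φ : ℝ → M → M) : Prop where
  symplectic : IsSymplecticIsotopy I σ φ
  hamiltonian : ∀ t ∈ Icc (0 : ℝ) 1, ∃ X : VField I M,
    IsGeneratorAt I φ t X ∧ IsHamiltonianField I σ X

/-- The map `I_{η,Ω} : Y ↦ ι(Y)Ω + η(Y)η` on the tangent space at `x`. -/
def coIso (η : OneForm I M) (Ω : TwoForm I M) (x : M) :
    TangentSpace I x →L[ℝ] (TangentSpace I x →L[ℝ] ℝ) :=
  Ω x + (η x).smulRight (η x)

/-- `(η, Ω)` is a cosymplectic structure on `M`: a smooth closed one-form and a smooth closed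
two-form making each tangent space a cosymplectic vector space. -/
structure IsCosymplectic (η : OneForm I M) (Ω : TwoForm I M) : Prop where
  smooth_one : η.Smooth I
  smooth_two : Ω.Smooth I
  antisymm : ∀ x (u v : TangentSpace I x), Ω x u v = - Ω x v u
  ne_zero : ∀ x, η x ≠ 0
  bijective : ∀ x, Function.Bijective (coIso I η Ω x)
  closed_one : ∀ x (u v : TangentSpace I x), η.extDeriv I x u v = 0
  closed_two : ∀ x (u v w : TangentSpace I x), Ω.extDeriv I x u v w = 0

/-- Isotopy through cosymplectic diffeomorphisms. -/
structure IsCosymplecticIsotopy (η : OneForm I M) (Ω : TwoForm I M) (φ : ℝ → M → M) :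
    Prop where
  isotopy : IsIsotopy I φ
  preserves_one : ∀ t ∈ Icc (0 : ℝ) 1, η.PreservedBy I (φ t)
  preserves_two : ∀ t ∈ Icc (0 : ℝ) 1, Ω.PreservedBy I (φ t)

/-- Co-Hamiltonian vector field: a cosymplectic vector field `X` (`L_X η = 0`, `L_X Ω = 0`)
such that `I_{η,Ω}(X)` is exact. -/
structure IsCoHamiltonianField (η : OneForm I M) (Ω : TwoForm I M) (X : VField I M) :
    Prop where
  smooth : X.Smooth I
  lie_one : ∀ x (u : TangentSpace I x), η.lieDeriv I X x u = 0
  lie_two : ∀ x (u v : TangentSpace I x), Ω.lieDeriv I X x u v = 0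
  exact : OneForm.Exact I (fun x ↦ coIso I η Ω x (X x))

/-- Cosymplectic isotopy that is generated at each time by a co-Hamiltonian vector field. -/
structure IsCoHamiltonianIsotopy (η : OneForm I M) (Ω : TwoForm I M) (φ : ℝ → M → M) :
    Prop where
  cosymplectic : IsCosymplecticIsotopy I η Ω φ
  hamiltonian : ∀ t ∈ Icc (0 : ℝ) 1, ∃ X : VField I M,
    IsGeneratorAt I φ t X ∧ IsCoHamiltonianField I η Ω X

end Isotopies

section Lift

variable {E : Type*} [NormedAddCommGroup E] [NormedSpace ℝ E]
  {H : Type*} [TopologicalSpace H] (I : ModelWithCorners ℝ E H)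
  {M : Type*} [TopologicalSpace M] [ChartedSpace H M]

/-- The angular form `dθ` on the unit circle `z = exp(iθ)` in `ℂ`: for `v` tangent to the circle
at `z`, `dθ(v)` is the imaginary part of `conj z * v`. -/
def dTheta : OneForm (𝓡 1) Circle := fun z ↦
  (Complex.imCLM.comp (ContinuousLinearMap.mul ℝ ℂ (starRingEnd ℂ (z : ℂ)))).comp
    (mfderiv (𝓡 1) 𝓘(ℝ, ℂ) (fun z : Circle ↦ (z : ℂ)) z)

/-- `p^* η` on `M × S¹`. -/
def pullFst (η : OneForm I M) : OneForm (I.prod (𝓡 1)) (M × Circle) := fun q ↦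
  (η q.1).comp (mfderiv (I.prod (𝓡 1)) I Prod.fst q)

/-- `π₂^* dθ` on `M × S¹`. -/
def pullTheta : OneForm (I.prod (𝓡 1)) (M × Circle) := fun q ↦
  (dTheta q.2).comp (mfderiv (I.prod (𝓡 1)) (𝓡 1) Prod.snd q)

/-- The two-form `p^* Ω + p^* η ∧ π₂^* dθ` on `M × S¹`. -/
def productForm (η : OneForm I M) (Ω : TwoForm I M) :
    TwoForm (I.prod (𝓡 1)) (M × Circle) := fun q ↦
  (ContinuousLinearMap.precomp ℝ (mfderiv (I.prod (𝓡 1)) I Prod.fst q)).comp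
      ((Ω q.1).comp (mfderiv (I.prod (𝓡 1)) I Prod.fst q))
    + ((pullFst I η q).smulRight (pullTheta I q) - (pullTheta I q).smulRight (pullFst I η q))

/-- The value of `η` on the velocity of the trajectory of `x` at time `s`. -/
def speed (η : OneForm I M) (φ : ℝ → M → M) (s : ℝ) (x : M) : ℝ :=
  η (φ s x) (velocity I φ s x)

/-- The lift `(x, θ) ↦ (φ_t(x), θ - ∫₀ᵗ η(φ̇_s)(φ_s(x)) ds mod 2π)` of `φ` to `M × S¹`, where
`θ mod 2π` corresponds to the point `exp(iθ)` of the circle. -/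
def lift (η : OneForm I M) (φ : ℝ → M → M) (t : ℝ) (q : M × Circle) : M × Circle :=
  (φ t q.1, Circle.exp (-∫ s in (0 : ℝ)..t, speed I η φ s q.1) * q.2)

end Lift

end Cosymplectic

end

noncomputable section

namespace Cosymplectic

open Filter Topology

theorem two_le_infty : (2 : ℕ∞ω) ≤ ∞ := WithTop.coe_le_coe.2 (le_top : (2 : ℕ∞) ≤ ⊤)

section Charts

variable {E : Type*} [NormedAddCommGroup E] [NormedSpace ℝ E]
  {H : Type*} [TopologicalSpace H] {I : ModelWithCorners ℝ E H}
  {M : Type*} [TopologicalSpace M] [ChartedSpace H M] [IsManifold I ∞ M]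
  {E' : Type*} [NormedAddCommGroup E'] [NormedSpace ℝ E']
  {H' : Type*} [TopologicalSpace H'] {I' : ModelWithCorners ℝ E' H'}
  {N : Type*} [TopologicalSpace N] [ChartedSpace H' N]

/-- A smooth one-form evaluated on a smooth vector field along a map is smooth. -/
theorem OneForm.Smooth.contMDiffWithinAt_apply {α : OneForm I M} (hα : α.Smooth I)
    {b : N → M} {V : ∀ n, TangentSpace I (b n)} {s : Set N} {n₀ : N}
    (hV : ContMDiffWithinAt I' I.tangent ∞ (fun n ↦ (⟨b n, V n⟩ : TangentBundle I M)) s n₀) :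
    ContMDiffWithinAt I' 𝓘(ℝ, ℝ) ∞ (fun n ↦ α (b n) (V n)) s n₀ := by
  have hb : ContMDiffWithinAt I' I ∞ b s n₀ :=
    (Bundle.contMDiffWithinAt_totalSpace.1 hV).1
  have h1 := (hα (b n₀)).comp_contMDiffWithinAt n₀ hb
  have h2 := ContMDiffWithinAt.clm_bundle_apply (F₁ := E) (F₂ := ℝ)
    (E₁ := (TangentSpace I : M → Type _)) (E₂ := Bundle.Trivial M ℝ)
    (b := b) (ϕ := fun n ↦ α (b n)) h1 hV
  exact (Bundle.contMDiffWithinAt_totalSpace.1 h2).2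

variable [I.Boundaryless]

theorem contMDiffAt_extChartAt_symm_of_mem {x₀ : M} {y : E} (hy : y ∈ (extChartAt I x₀).target) :
    ContMDiffAt 𝓘(ℝ, E) I ∞ (extChartAt I x₀).symm y :=
  (contMDiffOn_extChartAt_symm x₀).contMDiffAt ((isOpen_extChartAt_target x₀).mem_nhds hy)

omit [IsManifold I ∞ M] in
theorem OneForm.inChart_eq (α : OneForm I M) (x₀ : M) (y : E) :
    α.inChart I x₀ y = (α ((extChartAt I x₀).symm y)).comp
      (mfderiv 𝓘(ℝ, E) I (extChartAt I x₀).symm y) := by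
  unfold OneForm.inChart
  rw [I.range_eq_univ, mfderivWithin_univ]
  rfl

theorem OneForm.Smooth.contDiffOn_inChart [FiniteDimensional ℝ E]
    {α : OneForm I M} (hα : α.Smooth I) (x₀ : M) :
    ContDiffOn ℝ ∞ (α.inChart I x₀) (extChartAt I x₀).target := by
  rw [contDiffOn_clm_apply]
  intro v y hy
  rw [← contMDiffWithinAt_iff_contDiffWithinAt]
  have h1 : ContMDiffOn 𝓘(ℝ, E).tangent I.tangent ∞
      (tangentMapWithin 𝓘(ℝ, E) I (extChartAt I x₀).symm (extChartAt I x₀).target) _ :=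
    (contMDiffOn_extChartAt_symm (n := ∞) x₀).contMDiffOn_tangentMapWithin (m := ∞) (by simp)
      (isOpen_extChartAt_target x₀).uniqueMDiffOn
  have h2 : ContMDiff 𝓘(ℝ, E) 𝓘(ℝ, E).tangent ∞
      (fun y : E ↦ (⟨y, v⟩ : TangentBundle 𝓘(ℝ, E) E)) := by
    intro z
    rw [Bundle.contMDiffAt_totalSpace]
    refine ⟨contMDiffAt_id, ?_⟩
    simpa using contMDiffAt_const
  have h3 := hα.contMDiffWithinAt_apply (h1.comp h2.contMDiffOn (fun z hz ↦ hz) y hy)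
  refine h3.congr_of_eventuallyEq_of_mem ?_ hy
  filter_upwards [self_mem_nhdsWithin] with z hz
  rw [OneForm.inChart_eq]
  simp only [mfderivWithin_of_isOpen (isOpen_extChartAt_target x₀) hz]
  rfl

/-- Transition between the expressions of a one-form in two charts. -/
theorem OneForm.inChart_eventuallyEq (α : OneForm I M) (x₀ x : M) {y : E}
    (hy : y ∈ (extChartAt I x₀).target)
    (hx : (extChartAt I x₀).symm y ∈ (extChartAt I x).source) :
    ContDiffAt ℝ ∞ (extChartAt I x ∘ (extChartAt I x₀).symm) y ∧
    α.inChart I x₀ =ᶠ[𝓝 y] fun z ↦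
      (α.inChart I x ((extChartAt I x ∘ (extChartAt I x₀).symm) z)).comp
        (fderiv ℝ (extChartAt I x ∘ (extChartAt I x₀).symm) z) := by
  have hcont := (contMDiffAt_extChartAt_symm_of_mem (I := I) hy).continuousAt
  have hmem : ∀ᶠ z in 𝓝 y, z ∈ (extChartAt I x₀).target ∧
      (extChartAt I x₀).symm z ∈ (extChartAt I x).source :=
    (show ∀ᶠ z in 𝓝 y, z ∈ (extChartAt I x₀).target from
      (isOpen_extChartAt_target x₀).mem_nhds hy).and
      (hcont ((isOpen_extChartAt_source x).mem_nhds hx))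
  have hT : ∀ z, z ∈ (extChartAt I x₀).target →
      (extChartAt I x₀).symm z ∈ (extChartAt I x).source →
      ContDiffAt ℝ ∞ (extChartAt I x ∘ (extChartAt I x₀).symm) z := by
    intro z hz hzx
    rw [← contMDiffAt_iff_contDiffAt]
    exact ((contMDiffOn_extChartAt (I := I) (n := ∞) (x := x)).contMDiffAt
      ((chartAt H x).open_source.mem_nhds (by simpa using hzx))).comp z
        (contMDiffAt_extChartAt_symm_of_mem (I := I) hz)
  refine ⟨hT y hy hx, ?_⟩
  filter_upwards [hmem.eventually_nhds] with z hz
  obtain ⟨hz1, hz2⟩ := hz.self_of_nhds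
  have heq : (extChartAt I x₀).symm =ᶠ[𝓝 z]
      (extChartAt I x).symm ∘ (extChartAt I x ∘ (extChartAt I x₀).symm) := by
    filter_upwards [hz] with w hw
    exact ((extChartAt I x).left_inv hw.2).symm
  have hTz := (hT z hz1 hz2).differentiableAt (by simp)
  have hTt : (extChartAt I x ∘ (extChartAt I x₀).symm) z ∈ (extChartAt I x).target :=
    (extChartAt I x).map_source hz2
  have hd : mfderiv 𝓘(ℝ, E) I (extChartAt I x₀).symm z =
      (mfderiv 𝓘(ℝ, E) I (extChartAt I x).symm
        ((extChartAt I x ∘ (extChartAt I x₀).symm) z)).comp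
        (fderiv ℝ (extChartAt I x ∘ (extChartAt I x₀).symm) z) := by
    rw [heq.mfderiv_eq, mfderiv_comp z
      ((contMDiffAt_extChartAt_symm_of_mem (I := I) hTt).mdifferentiableAt (by simp))
      hTz.mdifferentiableAt, mfderiv_eq_fderiv]
    rfl
  rw [OneForm.inChart_eq, OneForm.inChart_eq, hd]
  have hpt : (extChartAt I x).symm ((extChartAt I x ∘ (extChartAt I x₀).symm) z) =
    (extChartAt I x₀).symm z := (extChartAt I x).left_inv hz2
  rw [hpt]
  rfl

/-- Pull-backs of closed one-forms on a vector space are closed. -/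
theorem fderiv_pullback_symm {β : E → E →L[ℝ] ℝ} {T : E → E} {y : E}
    (hT : ContDiffAt ℝ ∞ T y) (hβ : DifferentiableAt ℝ β (T y))
    (hs : ∀ u v, fderiv ℝ β (T y) u v = fderiv ℝ β (T y) v u) (u v : E) :
    fderiv ℝ (fun z ↦ (β (T z)).comp (fderiv ℝ T z)) y u v =
      fderiv ℝ (fun z ↦ (β (T z)).comp (fderiv ℝ T z)) y v u := by
  have hT1 : HasFDerivAt T (fderiv ℝ T y) y := (hT.differentiableAt (by simp)).hasFDerivAt
  have hT2 : HasFDerivAt (fderiv ℝ T) (fderiv ℝ (fderiv ℝ T) y) y :=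
    ((hT.fderiv_right (m := 1) (by rw [one_add_one_eq_two]; exact two_le_infty)).differentiableAt (by simp)).hasFDerivAt
  have h := (hβ.hasFDerivAt.comp y hT1).clm_comp hT2
  have hsymm : fderiv ℝ (fderiv ℝ T) y u v = fderiv ℝ (fderiv ℝ T) y v u :=
    (hT.isSymmSndFDerivAt (by simp; exact two_le_infty)).eq u v
  have h' : HasFDerivAt (fun z ↦ (β (T z)).comp (fderiv ℝ T z)) _ y := h
  rw [h'.fderiv]
  simp [hsymm, hs (fderiv ℝ T y u) (fderiv ℝ T y v)]

theorem OneForm.fderiv_inChart_symm [FiniteDimensional ℝ E] {α : OneForm I M} (hα : α.Smooth I)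
    (hc : ∀ x (u v : TangentSpace I x), α.extDeriv I x u v = 0) (x₀ : M) {y : E}
    (hy : y ∈ (extChartAt I x₀).target) (u v : E) :
    fderiv ℝ (α.inChart I x₀) y u v = fderiv ℝ (α.inChart I x₀) y v u := by
  set x := (extChartAt I x₀).symm y with hxdef
  obtain ⟨hT, heq⟩ := α.inChart_eventuallyEq x₀ x hy (mem_extChartAt_source x)
  rw [heq.fderiv_eq]
  have hTy : (extChartAt I x ∘ (extChartAt I x₀).symm) y = extChartAt I x x := rfl
  refine fderiv_pullback_symm hT ?_ ?_ u v
  · rw [hTy]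
    exact ((hα.contDiffOn_inChart x).contDiffAt
      (extChartAt_target_mem_nhds x)).differentiableAt (by simp)
  · intro u v
    rw [hTy]
    have := hc x u v
    simpa [OneForm.extDeriv, I.range_eq_univ, sub_eq_zero] using this

/-- **Poincaré lemma**: a smooth closed one-form is locally the differential of a smooth
function. -/
theorem OneForm.exists_local_primitive [FiniteDimensional ℝ E] {α : OneForm I M}
    (hα : α.Smooth I)
    (hc : ∀ x (u v : TangentSpace I x), α.extDeriv I x u v = 0) (x₀ : M) :
    ∃ U : Set M, IsOpen U ∧ x₀ ∈ U ∧ ∃ g : M → ℝ, ContMDiffOn I 𝓘(ℝ, ℝ) ∞ g U ∧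
      ∀ x ∈ U, mfderiv I 𝓘(ℝ, ℝ) g x = α x := by
  obtain ⟨r, hr, hball⟩ := Metric.isOpen_iff.1 (isOpen_extChartAt_target (I := I) x₀) _
    (mem_extChartAt_target (I := I) x₀)
  set B := Metric.ball (extChartAt I x₀ x₀) r
  have hβ : ContDiffOn ℝ ∞ (α.inChart I x₀) B := (hα.contDiffOn_inChart x₀).mono hball
  obtain ⟨G, hG⟩ := (convex_ball (extChartAt I x₀ x₀) r).exists_forall_hasFDerivAt_of_fderiv_symmetric
    Metric.isOpen_ball (hβ.differentiableOn (by simp))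
    (fun a ha u v ↦ OneForm.fderiv_inChart_symm hα hc x₀ (hball ha) u v)
  have hGs : ContDiffOn ℝ ∞ G B := by
    rw [contDiffOn_infty_iff_fderiv_of_isOpen Metric.isOpen_ball]
    exact ⟨fun a ha ↦ (hG a ha).differentiableAt.differentiableWithinAt,
      hβ.congr fun a ha ↦ (hG a ha).fderiv⟩
  refine ⟨(extChartAt I x₀).source ∩ extChartAt I x₀ ⁻¹' B,
    isOpen_extChartAt_preimage' x₀ Metric.isOpen_ball,
    ⟨mem_extChartAt_source x₀, Metric.mem_ball_self hr⟩, G ∘ extChartAt I x₀, ?_, ?_⟩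
  · exact hGs.contMDiffOn.comp ((contMDiffOn_extChartAt (I := I) (n := ∞) (x := x₀)).mono
      (fun x hx ↦ by simpa using hx.1)) (fun x hx ↦ hx.2)
  · rintro x ⟨hx, hxB⟩
    have hx' : x ∈ (chartAt H x₀).source := by simpa using hx
    rw [mfderiv_comp x (hG _ hxB).differentiableAt.mdifferentiableAt
      (mdifferentiableAt_extChartAt hx'), mfderiv_eq_fderiv, (hG _ hxB).fderiv]
    have h1 := mfderivWithin_extChartAt_symm_comp_mfderiv_extChartAt' (I := I) hx
    rw [I.range_eq_univ, mfderivWithin_univ] at h1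
    rw [OneForm.inChart_eq, (extChartAt I x₀).left_inv hx]
    ext v
    exact congrArg (fun A ↦ α x (A v)) h1

/-- Differentials of smooth functions are closed. -/
theorem extDeriv_differential {F : M → ℝ} (hF : ContMDiff I 𝓘(ℝ, ℝ) ∞ F) (x : M)
    (u v : TangentSpace I x) : (differential I F).extDeriv I x u v = 0 := by
  have hC : ContDiffAt ℝ ∞ (F ∘ (extChartAt I x).symm) (extChartAt I x x) := by
    rw [← contMDiffAt_iff_contDiffAt]
    exact (hF _).comp _ (contMDiffAt_extChartAt_symm_of_mem (mem_extChartAt_target x))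
  have heq : (differential I F).inChart I x =ᶠ[𝓝 (extChartAt I x x)]
      fderiv ℝ (F ∘ (extChartAt I x).symm) := by
    filter_upwards [extChartAt_target_mem_nhds (I := I) x] with z hz
    rw [OneForm.inChart_eq, ← mfderiv_eq_fderiv, mfderiv_comp z
      ((hF _).mdifferentiableAt (by simp))
      ((contMDiffAt_extChartAt_symm_of_mem (I := I) hz).mdifferentiableAt (by simp))]
    rfl
  have hs := (hC.isSymmSndFDerivAt (by simp; exact two_le_infty)).eq u v
  simp only [OneForm.extDeriv, I.range_eq_univ, fderivWithin_univ, heq.fderiv_eq]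
  exact sub_eq_zero.2 hs

end Charts

section Flux

variable {E : Type*} [NormedAddCommGroup E] [NormedSpace ℝ E]
  {H : Type*} [TopologicalSpace H] {I : ModelWithCorners ℝ E H}
  {M : Type*} [TopologicalSpace M] [ChartedSpace H M]

/-- The integral of `η` along the trajectory of `x` up to time `t`. -/
def flux (I : ModelWithCorners ℝ E H) (η : OneForm I M) (φ : ℝ → M → M) (t : ℝ) (x : M) : ℝ :=
  ∫ s in (0 : ℝ)..t, speed I η φ s x

theorem IsIsotopy.contMDiff {φ : ℝ → M → M} (hφ : IsIsotopy I φ) {t : ℝ} (ht : t ∈ Icc (0 : ℝ) 1) :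
    ContMDiff I I ∞ (φ t) := by
  obtain ⟨f, hf⟩ := hφ.diffeo t ht
  exact (funext hf : (f : M → M) = φ t) ▸ f.contMDiff

theorem IsIsotopy.contMDiffOn_trajectory {φ : ℝ → M → M} (hφ : IsIsotopy I φ) (x : M) :
    ContMDiffOn 𝓘(ℝ, ℝ) I ∞ (fun s ↦ φ s x) (Icc 0 1) :=
  hφ.smooth.comp (contMDiff_id.prodMk contMDiff_const).contMDiffOn (fun _ hs ↦ ⟨hs, mem_univ _⟩)

theorem uniqueMDiffOn_Icc_zero_one : UniqueMDiffOn 𝓘(ℝ, ℝ) (Icc (0 : ℝ) 1) :=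
  (uniqueDiffOn_Icc zero_lt_one).uniqueMDiffOn

variable [IsManifold I ∞ M]

theorem continuousOn_speed {η : OneForm I M} (hη : η.Smooth I) {φ : ℝ → M → M}
    (hφ : IsIsotopy I φ) (x : M) : ContinuousOn (fun s ↦ speed I η φ s x) (Icc 0 1) := by
  intro t ht
  have h1 := (hφ.contMDiffOn_trajectory x).contMDiffOn_tangentMapWithin (m := ∞) (by simp)
    uniqueMDiffOn_Icc_zero_one
  have h2 : ContMDiff 𝓘(ℝ, ℝ) 𝓘(ℝ, ℝ).tangent ∞
      (fun y : ℝ ↦ (⟨y, (1 : ℝ)⟩ : TangentBundle 𝓘(ℝ, ℝ) ℝ)) := by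
    intro z
    rw [Bundle.contMDiffAt_totalSpace]
    refine ⟨contMDiffAt_id, ?_⟩
    simpa using contMDiffAt_const
  exact (hη.contMDiffWithinAt_apply (h1.comp h2.contMDiffOn (fun z hz ↦ hz) t ht)).continuousWithinAt

omit [IsManifold I ∞ M] in
theorem hasDerivWithinAt_primitive_trajectory {η : OneForm I M} {φ : ℝ → M → M}
    (hφ : IsIsotopy I φ) {U : Set M} (hU : IsOpen U) {g : M → ℝ}
    (hg : ContMDiffOn I 𝓘(ℝ, ℝ) ∞ g U) (hgη : ∀ x ∈ U, mfderiv I 𝓘(ℝ, ℝ) g x = η x)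
    {t : ℝ} (ht : t ∈ Icc (0 : ℝ) 1) {x : M} (hx : φ t x ∈ U) :
    HasDerivWithinAt (fun s ↦ g (φ s x)) (speed I η φ t x) (Icc 0 1) t := by
  have hgx : MDifferentiableAt I 𝓘(ℝ, ℝ) g (φ t x) :=
    (hg.contMDiffAt (hU.mem_nhds hx)).mdifferentiableAt (by simp)
  have hc : MDifferentiableWithinAt 𝓘(ℝ, ℝ) I (fun s ↦ φ s x) (Icc 0 1) t :=
    (hφ.contMDiffOn_trajectory x t ht).mdifferentiableWithinAt (by simp)
  let L : ℝ →L[ℝ] ℝ := (mfderiv I 𝓘(ℝ, ℝ) g (φ t x)).comp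
    (mfderivWithin 𝓘(ℝ, ℝ) I (fun s ↦ φ s x) (Icc 0 1) t)
  have h : HasFDerivWithinAt (fun s ↦ g (φ s x)) L (Icc 0 1) t :=
    (hgx.hasMFDerivAt.comp_hasMFDerivWithinAt t hc.hasMFDerivWithinAt).hasFDerivWithinAt
  have e : speed I η φ t x = L 1 := by
    simp only [L, hgη _ hx]
    rfl
  rw [e]
  exact h.hasDerivWithinAt

variable [I.Boundaryless] [FiniteDimensional ℝ E]

theorem exists_flux_eq_near {η : OneForm I M} (hη : η.Smooth I)
    (hc : ∀ x (u v : TangentSpace I x), η.extDeriv I x u v = 0) {φ : ℝ → M → M}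
    (hφ : IsIsotopy I φ) {t₀ : ℝ} (ht₀ : t₀ ∈ Icc (0 : ℝ) 1) (x₀ : M) :
    ∃ U : Set M, IsOpen U ∧ ∃ g : M → ℝ, ContMDiffOn I 𝓘(ℝ, ℝ) ∞ g U ∧
      (∀ x ∈ U, mfderiv I 𝓘(ℝ, ℝ) g x = η x) ∧
      ∀ᶠ p : ℝ × M in 𝓝[Icc 0 1] t₀ ×ˢ 𝓝 x₀, p.1 ∈ Icc (0 : ℝ) 1 ∧ φ p.1 p.2 ∈ U ∧
        φ t₀ p.2 ∈ U ∧
        flux I η φ p.1 p.2 = flux I η φ t₀ p.2 + (g (φ p.1 p.2) - g (φ t₀ p.2)) := by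
  obtain ⟨U, hU, hxU, g, hg, hgη⟩ := OneForm.exists_local_primitive hη hc (φ t₀ x₀)
  refine ⟨U, hU, g, hg, hgη, ?_⟩
  have h1 : Tendsto (fun p : ℝ × M ↦ φ p.1 p.2) (𝓝[Icc 0 1] t₀ ×ˢ 𝓝 x₀) (𝓝 (φ t₀ x₀)) := by
    have := (hφ.smooth (t₀, x₀) ⟨ht₀, mem_univ _⟩).continuousWithinAt
    rwa [ContinuousWithinAt, nhdsWithin_prod_eq, nhdsWithin_univ] at this
  obtain ⟨pa, hpa, pb, hpb, hab⟩ := eventually_prod_iff.1 (h1 (hU.mem_nhds hxU))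
  obtain ⟨ε, hε, hball⟩ := Metric.mem_nhdsWithin_iff.1 hpa
  have hball' : ∀ᶠ s in 𝓝[Icc 0 1] t₀, s ∈ Metric.ball t₀ ε ∧ s ∈ Icc (0 : ℝ) 1 :=
    inter_mem (mem_nhdsWithin_of_mem_nhds (Metric.ball_mem_nhds t₀ hε)) self_mem_nhdsWithin
  filter_upwards [hball'.prod_mk hpb] with p hp
  obtain ⟨⟨htb, ht⟩, hx⟩ := hp
  obtain ⟨t, x⟩ := p
  have hsub : uIcc t₀ t ⊆ Metric.ball t₀ ε ∩ Icc 0 1 := fun s hs ↦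
    ⟨(convex_ball t₀ ε).ordConnected.uIcc_subset (Metric.mem_ball_self hε) htb hs,
      ordConnected_Icc.uIcc_subset ht₀ ht hs⟩
  have hUs : ∀ s ∈ uIcc t₀ t, φ s x ∈ U := fun s hs ↦ hab (hball (hsub hs)) hx
  have hd : ∀ s ∈ uIcc t₀ t,
      HasDerivWithinAt (fun s ↦ g (φ s x)) (speed I η φ s x) (Icc 0 1) s := fun s hs ↦
    hasDerivWithinAt_primitive_trajectory hφ hU hg hgη (hsub hs).2 (hUs s hs)
  have hint : ∀ a ∈ Icc (0 : ℝ) 1, ∀ b ∈ Icc (0 : ℝ) 1,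
      IntervalIntegrable (fun s ↦ speed I η φ s x) MeasureTheory.volume a b := fun a ha b hb ↦
    ((continuousOn_speed hη hφ x).mono (ordConnected_Icc.uIcc_subset ha hb)).intervalIntegrable
  refine ⟨ht, hUs t right_mem_uIcc, hUs t₀ left_mem_uIcc, ?_⟩
  have h0 : (0 : ℝ) ∈ Icc (0 : ℝ) 1 := by simp
  have hftc : ∫ s in t₀..t, speed I η φ s x = g (φ t x) - g (φ t₀ x) := by
    refine intervalIntegral.integral_eq_sub_of_hasDeriv_right
      (f := fun s ↦ g (φ s x)) (fun s hs ↦ ?_) (fun s hs ↦ ?_) (hint _ ht₀ _ ht)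
    · exact (hd s hs).continuousWithinAt.mono (fun r hr ↦ (hsub hr).2)
    · have hs' : s ∈ uIcc t₀ t := Ioo_subset_Icc_self hs
      have hI : Icc (0 : ℝ) 1 ∈ 𝓝 s :=
        mem_of_superset (isOpen_Ioo.mem_nhds hs) fun r hr ↦
          (hsub (show r ∈ uIcc t₀ t from Ioo_subset_Icc_self hr)).2
      exact ((hd s hs').hasDerivAt hI).hasDerivWithinAt
  simp only [flux]
  rw [← hftc, intervalIntegral.integral_add_adjacent_intervals (hint _ h0 _ ht₀) (hint _ ht₀ _ ht)]

theorem flux_induction {η : OneForm I M} (hη : η.Smooth I)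
    (hc : ∀ x (u v : TangentSpace I x), η.extDeriv I x u v = 0) {φ : ℝ → M → M}
    (hφ : IsIsotopy I φ) (x : M) {t : ℝ} (ht : t ∈ Icc (0 : ℝ) 1) :
    ContMDiffAt I 𝓘(ℝ, ℝ) ∞ (flux I η φ t) x ∧
    ∀ u : TangentSpace I x, mfderiv I 𝓘(ℝ, ℝ) (flux I η φ t) x u =
      η (φ t x) (mfderiv I I (φ t) x u) - η x u := by
  let Q : ℝ → Prop := fun t ↦ ContMDiffAt I 𝓘(ℝ, ℝ) ∞ (flux I η φ t) x ∧
    ∀ u : TangentSpace I x, mfderiv I 𝓘(ℝ, ℝ) (flux I η φ t) x u =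
      η (φ t x) (mfderiv I I (φ t) x u) - η x u
  have hQ0 : Q 0 := by
    have h0 : flux I η φ 0 = fun _ ↦ (0 : ℝ) := by funext y; simp [flux]
    have h1 : φ 0 = id := funext hφ.zero
    refine ⟨h0 ▸ contMDiffAt_const, fun u ↦ ?_⟩
    rw [h0, h1, mfderiv_id, mfderiv_const]
    exact (sub_self (η x u)).symm
  have hstep : ∀ t₀ ∈ Icc (0 : ℝ) 1, ∀ᶠ t in 𝓝[Icc 0 1] t₀, Q t₀ ↔ Q t := by
    intro t₀ ht₀
    obtain ⟨U, hU, g, hg, hgη, hev⟩ := exists_flux_eq_near hη hc hφ ht₀ x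
    filter_upwards [hev.curry] with t hev
    obtain ⟨ht, h1, h2, -⟩ := hev.self_of_nhds
    have hgφ : ∀ s ∈ Icc (0 : ℝ) 1, φ s x ∈ U →
        ContMDiffAt I 𝓘(ℝ, ℝ) ∞ (g ∘ φ s) x ∧
        ∀ u : TangentSpace I x, mfderiv I 𝓘(ℝ, ℝ) (g ∘ φ s) x u =
          η (φ s x) (mfderiv I I (φ s) x u) := by
      intro s hs hsU
      have hgs := hg.contMDiffAt (hU.mem_nhds hsU)
      refine ⟨hgs.comp x (hφ.contMDiff hs x), fun u ↦ ?_⟩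
      rw [mfderiv_comp x (hgs.mdifferentiableAt (by simp))
        ((hφ.contMDiff hs x).mdifferentiableAt (by simp)), hgη _ hsU]
      rfl
    have key : ∀ a b, a ∈ Icc (0 : ℝ) 1 → b ∈ Icc (0 : ℝ) 1 → φ a x ∈ U → φ b x ∈ U →
        (flux I η φ b =ᶠ[𝓝 x] flux I η φ a + (g ∘ φ b - g ∘ φ a)) → Q a → Q b := by
      intro a b ha hb haU hbU heq hQ
      obtain ⟨ha1, ha2⟩ := hgφ a ha haU
      obtain ⟨hb1, hb2⟩ := hgφ b hb hbU
      refine ⟨(hQ.1.add (hb1.sub ha1)).congr_of_eventuallyEq heq, fun u ↦ ?_⟩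
      have d1 := hQ.1.mdifferentiableAt (n := ∞) (by simp)
      have d2 := hb1.mdifferentiableAt (n := ∞) (by simp)
      have d3 := ha1.mdifferentiableAt (n := ∞) (by simp)
      rw [heq.mfderiv_eq, mfderiv_add d1 (d2.sub d3), mfderiv_sub d2 d3]
      have e1 := hQ.2 u
      have e2 := ha2 u
      have e3 := hb2 u
      exact (congrArg₂ (fun r s : ℝ ↦ r + s) e1
        (congrArg₂ (fun r s : ℝ ↦ r - s) e3 e2)).trans (by ring)
    refine ⟨key t₀ t ht₀ ht h2 h1 ?_, key t t₀ ht ht₀ h1 h2 ?_⟩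
    · filter_upwards [hev] with y hy
      simpa using hy.2.2.2
    · filter_upwards [hev] with y hy
      simp only [Pi.add_apply, Pi.sub_apply, Function.comp_apply]
      linarith [hy.2.2.2]
  exact (isPreconnected_Icc.induction₂ (fun a b ↦ (Q a ↔ Q b)) hstep
    (fun _ _ _ _ _ _ h h' ↦ h.trans h') (fun _ _ _ _ h ↦ h.symm)
    (left_mem_Icc.2 zero_le_one) ht).1 hQ0

theorem contMDiff_flux {η : OneForm I M} (hη : η.Smooth I)
    (hc : ∀ x (u v : TangentSpace I x), η.extDeriv I x u v = 0) {φ : ℝ → M → M}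
    (hφ : IsIsotopy I φ) {t : ℝ} (ht : t ∈ Icc (0 : ℝ) 1) :
    ContMDiff I 𝓘(ℝ, ℝ) ∞ (flux I η φ t) :=
  fun x ↦ (flux_induction hη hc hφ x ht).1

/-- The pull-back of a closed one-form under an isotopy differs from it by the differential of
the flux. -/
theorem mfderiv_flux {η : OneForm I M} (hη : η.Smooth I)
    (hc : ∀ x (u v : TangentSpace I x), η.extDeriv I x u v = 0) {φ : ℝ → M → M}
    (hφ : IsIsotopy I φ) {t : ℝ} (ht : t ∈ Icc (0 : ℝ) 1) (x : M) (u : TangentSpace I x) :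
    mfderiv I 𝓘(ℝ, ℝ) (flux I η φ t) x u = η (φ t x) (mfderiv I I (φ t) x u) - η x u :=
  (flux_induction hη hc hφ x ht).2 u

theorem contMDiffOn_flux {η : OneForm I M} (hη : η.Smooth I)
    (hc : ∀ x (u v : TangentSpace I x), η.extDeriv I x u v = 0) {φ : ℝ → M → M}
    (hφ : IsIsotopy I φ) :
    ContMDiffOn (𝓘(ℝ, ℝ).prod I) 𝓘(ℝ, ℝ) ∞ (fun p : ℝ × M ↦ flux I η φ p.1 p.2)
      (Icc 0 1 ×ˢ univ) := by
  rintro ⟨t₀, x₀⟩ ⟨ht₀, -⟩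
  obtain ⟨U, hU, g, hg, hgη, hev⟩ := exists_flux_eq_near hη hc hφ ht₀ x₀
  rw [← nhdsWithin_univ x₀, ← nhdsWithin_prod_eq] at hev
  obtain ⟨-, hU1, hU2, -⟩ := hev.self_of_nhdsWithin (⟨ht₀, mem_univ _⟩ : (t₀, x₀) ∈ Icc 0 1 ×ˢ univ)
  have hg0 := hg.contMDiffAt (hU.mem_nhds hU1)
  have h1 : ContMDiffWithinAt (𝓘(ℝ, ℝ).prod I) 𝓘(ℝ, ℝ) ∞ (fun p : ℝ × M ↦ g (φ p.1 p.2))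
      (Icc 0 1 ×ˢ univ) (t₀, x₀) :=
    hg0.comp_contMDiffWithinAt (t₀, x₀) (hφ.smooth _ ⟨ht₀, mem_univ _⟩)
  have h2 : ContMDiffAt (𝓘(ℝ, ℝ).prod I) 𝓘(ℝ, ℝ) ∞ (fun p : ℝ × M ↦ g (φ t₀ p.2)) (t₀, x₀) :=
    ContMDiffAt.comp (g := fun x ↦ g (φ t₀ x)) (t₀, x₀)
      (hg0.comp x₀ (hφ.contMDiff ht₀ x₀)) contMDiffAt_snd
  have h3 : ContMDiff (𝓘(ℝ, ℝ).prod I) 𝓘(ℝ, ℝ) ∞ (fun p : ℝ × M ↦ flux I η φ t₀ p.2) :=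
    (contMDiff_flux hη hc hφ ht₀).comp contMDiff_snd
  exact (h3.contMDiffAt.contMDiffWithinAt.add (h1.sub h2.contMDiffWithinAt)).congr_of_eventuallyEq_of_mem
    (hev.mono fun p hp ↦ hp.2.2.2) ⟨ht₀, mem_univ _⟩

end Flux

section AngularForm

variable {E : Type*} [NormedAddCommGroup E] [NormedSpace ℝ E]
  {H : Type*} [TopologicalSpace H] {I : ModelWithCorners ℝ E H}
  {N : Type*} [TopologicalSpace N] [ChartedSpace H N]

theorem contMDiff_circle_coe : ContMDiff (𝓡 1) 𝓘(ℝ, ℂ) ∞ (fun z : Circle ↦ (z : ℂ)) :=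
  haveI := finrank_real_complex_fact'
  contMDiff_coe_sphere (E := ℂ) (n := 1)

theorem dTheta_mfderiv {G : N → Circle} {x : N} (hG : MDifferentiableAt I (𝓡 1) G x)
    (v : TangentSpace I x) :
    dTheta (G x) (mfderiv I (𝓡 1) G x v) =
      Complex.im (starRingEnd ℂ (G x : ℂ) *
        (by exact mfderiv I 𝓘(ℝ, ℂ) (fun y ↦ (G y : ℂ)) x v : ℂ)) := by
  have h : mfderiv I 𝓘(ℝ, ℂ) (fun y ↦ (G y : ℂ)) x =
      (mfderiv (𝓡 1) 𝓘(ℝ, ℂ) (fun z : Circle ↦ (z : ℂ)) (G x)).comp (mfderiv I (𝓡 1) G x) :=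
    mfderiv_comp x ((contMDiff_circle_coe _).mdifferentiableAt (by simp)) hG
  rw [h]
  rfl

theorem dTheta_mfderiv_exp_mul {h : N → ℝ} {w : N → Circle} {x : N}
    (hh : MDifferentiableAt I 𝓘(ℝ, ℝ) h x) (hw : MDifferentiableAt I (𝓡 1) w x)
    (v : TangentSpace I x) :
    dTheta (Circle.exp (h x) * w x) (mfderiv I (𝓡 1) (fun y ↦ Circle.exp (h y) * w y) x v) =
      (by exact mfderiv I 𝓘(ℝ, ℝ) h x v : ℝ) + dTheta (w x) (mfderiv I (𝓡 1) w x v) := by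
  have he : MDifferentiableAt I (𝓡 1) (fun y ↦ Circle.exp (h y)) x :=
    ((contMDiff_circleExp (m := ∞) (h x)).mdifferentiableAt (by simp)).comp x hh
  have hmul : MDifferentiableAt I (𝓡 1) (fun y ↦ Circle.exp (h y) * w y) x :=
    MDifferentiableAt.comp (g := fun p : Circle × Circle ↦ p.1 * p.2)
      (f := fun y ↦ (Circle.exp (h y), w y)) x
      ((contMDiff_mul (𝓡 1) ω (G := Circle) _).mdifferentiableAt (by simp)) (he.prodMk hw)
  rw [dTheta_mfderiv hmul, dTheta_mfderiv hw]
  have hc : HasDerivAt (fun r : ℝ ↦ Complex.exp (r * Complex.I))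
      (Complex.exp (h x * Complex.I) * Complex.I) (h x) := by
    have := ((hasDerivAt_id (h x)).ofReal_comp.mul_const Complex.I).cexp
    simpa using this
  have h1 : HasMFDerivAt I 𝓘(ℝ, ℂ) (fun y ↦ Complex.exp (h y * Complex.I)) x
      ((ContinuousLinearMap.toSpanSingleton ℝ
        (Complex.exp (h x * Complex.I) * Complex.I)).comp (mfderiv I 𝓘(ℝ, ℝ) h x)) :=
    HasMFDerivAt.comp (g := fun r : ℝ ↦ Complex.exp (r * Complex.I)) x
      hc.hasFDerivAt.hasMFDerivAt hh.hasMFDerivAt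
  have h2 : HasMFDerivAt I 𝓘(ℝ, ℂ) (fun y ↦ (w y : ℂ)) x
      (mfderiv I 𝓘(ℝ, ℂ) (fun y ↦ (w y : ℂ)) x) :=
    (((contMDiff_circle_coe _).mdifferentiableAt (by simp)).comp x hw).hasMFDerivAt
  have h3 := h1.mul h2
  have e : (fun y ↦ ((Circle.exp (h y) * w y : Circle) : ℂ)) =
      (fun y ↦ Complex.exp (h y * Complex.I)) * fun y ↦ (w y : ℂ) := by
    funext y; simp
  rw [e, h3.mfderiv]
  set e₁ := Circle.exp (h x) with he₁
  have hce : Complex.exp (h x * Complex.I) = (e₁ : ℂ) := by simp [he₁]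
  have key : ∀ (D : ℝ) (W : ℂ), Complex.im (starRingEnd ℂ ((e₁ * w x : Circle) : ℂ) *
      (Complex.exp (h x * Complex.I) * W +
        (w x : ℂ) * (D • (Complex.exp (h x * Complex.I) * Complex.I)))) =
      D + Complex.im (starRingEnd ℂ (w x : ℂ) * W) := by
    intro D W
    have hu : ∀ z : Circle, starRingEnd ℂ (z : ℂ) * z = 1 := fun z ↦ by
      rw [← Circle.coe_inv_eq_conj, ← Circle.coe_mul, inv_mul_cancel, Circle.coe_one]
    have : starRingEnd ℂ ((e₁ * w x : Circle) : ℂ) * (Complex.exp (h x * Complex.I) * W +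
        (w x : ℂ) * (D • (Complex.exp (h x * Complex.I) * Complex.I))) =
        starRingEnd ℂ (w x : ℂ) * W + D * Complex.I := by
      rw [hce, Circle.coe_mul, map_mul, Complex.real_smul]
      linear_combination (starRingEnd ℂ (w x : ℂ) * W +
        starRingEnd ℂ (w x : ℂ) * (w x : ℂ) * D * Complex.I) * hu e₁ + D * Complex.I * hu (w x)
    rw [this]
    simp [add_comm]
  exact key _ _

theorem exists_dTheta_eq_one (z : Circle) : ∃ v : TangentSpace (𝓡 1) z, dTheta z v = 1 := by
  have h := dTheta_mfderiv_exp_mul (I := 𝓘(ℝ, ℝ)) (h := id) (w := fun _ : ℝ ↦ z) (x := 0)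
    mdifferentiableAt_id mdifferentiableAt_const (1 : ℝ)
  rw [mfderiv_id, mfderiv_const] at h
  have h0 : Circle.exp (id (0 : ℝ)) * z = z := by simp
  have h1 : ∀ z' : Circle, z' = z → (∃ v : TangentSpace (𝓡 1) z', dTheta z' v = 1) →
      ∃ v : TangentSpace (𝓡 1) z, dTheta z v = 1 := by
    rintro z' rfl h
    exact h
  exact h1 _ h0 ⟨_, h.trans ((congrArg (fun r : ℝ ↦ 1 + r) (map_zero (dTheta z))).trans (add_zero 1))⟩

end AngularForm

section ProductForm

variable {E : Type*} [NormedAddCommGroup E] [NormedSpace ℝ E]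
  {H : Type*} [TopologicalSpace H] {I : ModelWithCorners ℝ E H}
  {M : Type*} [TopologicalSpace M] [ChartedSpace H M]

theorem productForm_apply (η : OneForm I M) (Ω : TwoForm I M) (q : M × Circle)
    (u v : TangentSpace (I.prod (𝓡 1)) q) :
    productForm I η Ω q u v = Ω q.1 (mfderiv (I.prod (𝓡 1)) I Prod.fst q u)
        (mfderiv (I.prod (𝓡 1)) I Prod.fst q v) +
      (η q.1 (mfderiv (I.prod (𝓡 1)) I Prod.fst q u) *
        dTheta q.2 (mfderiv (I.prod (𝓡 1)) (𝓡 1) Prod.snd q v) -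
      dTheta q.2 (mfderiv (I.prod (𝓡 1)) (𝓡 1) Prod.snd q u) *
        η q.1 (mfderiv (I.prod (𝓡 1)) I Prod.fst q v)) :=
  rfl

theorem productForm_pair (η : OneForm I M) (Ω : TwoForm I M) (x : M) (z : Circle)
    (u v : TangentSpace I x) (a b : TangentSpace (𝓡 1) z) :
    productForm I η Ω (x, z) (u, a) (v, b) = Ω x u v + (η x u * dTheta z b - dTheta z a * η x v) := by
  refine (productForm_apply η Ω (x, z) (u, a) (v, b)).trans ?_
  rw [mfderiv_fst, mfderiv_snd]
  rfl

theorem lift_eq (η : OneForm I M) (φ : ℝ → M → M) (t : ℝ) (q : M × Circle) :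
    lift I η φ t q = (φ t q.1, Circle.exp (-flux I η φ t q.1) * q.2) :=
  rfl

variable [IsManifold I ∞ M] [I.Boundaryless] [FiniteDimensional ℝ E]

theorem isIsotopy_lift {η : OneForm I M} (hη : η.Smooth I)
    (hc : ∀ x (u v : TangentSpace I x), η.extDeriv I x u v = 0) {φ : ℝ → M → M}
    (hφ : IsIsotopy I φ) : IsIsotopy (I.prod (𝓡 1)) (lift I η φ) where
  smooth := by
    have hp : ContMDiffOn (𝓘(ℝ, ℝ).prod (I.prod (𝓡 1))) (𝓘(ℝ, ℝ).prod I) ∞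
        (fun p : ℝ × (M × Circle) ↦ (p.1, p.2.1)) (Icc 0 1 ×ˢ univ) :=
      (contMDiff_fst.prodMk (contMDiff_fst.comp contMDiff_snd)).contMDiffOn
    have hm : MapsTo (fun p : ℝ × (M × Circle) ↦ (p.1, p.2.1)) (Icc 0 1 ×ˢ univ)
        (Icc (0 : ℝ) 1 ×ˢ univ) := fun p hp ↦ ⟨hp.1, mem_univ _⟩
    have h1 := hφ.smooth.comp hp hm
    have h2 : ContMDiffOn (𝓘(ℝ, ℝ).prod (I.prod (𝓡 1))) (𝓡 1) ∞
        (fun p : ℝ × (M × Circle) ↦ Circle.exp (-flux I η φ p.1 p.2.1)) (Icc 0 1 ×ˢ univ) :=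
      (contMDiff_circleExp (m := ∞)).comp_contMDiffOn (((contMDiffOn_flux hη hc hφ).comp hp hm).neg)
    have h3 : ContMDiffOn (𝓘(ℝ, ℝ).prod (I.prod (𝓡 1))) (𝓡 1) ∞
        (fun p : ℝ × (M × Circle) ↦ p.2.2) (Icc 0 1 ×ˢ univ) :=
      (contMDiff_snd.comp contMDiff_snd).contMDiffOn
    exact h1.prodMk (((contMDiff_mul (𝓡 1) ω (G := Circle)).of_le le_top).comp_contMDiffOn
      (h2.prodMk h3))
  diffeo := by
    intro t ht
    obtain ⟨f, hf⟩ := hφ.diffeo t ht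
    have hfl := contMDiff_flux hη hc hφ ht
    have hmul : ContMDiff ((𝓡 1).prod (𝓡 1)) (𝓡 1) ∞ (fun p : Circle × Circle ↦ p.1 * p.2) :=
      (contMDiff_mul (𝓡 1) ω (G := Circle)).of_le le_top
    refine ⟨{
      toFun := fun q ↦ (f q.1, Circle.exp (-flux I η φ t q.1) * q.2)
      invFun := fun q ↦ (f.symm q.1, Circle.exp (flux I η φ t (f.symm q.1)) * q.2)
      left_inv := fun q ↦ by simp [← mul_assoc]
      right_inv := fun q ↦ by simp [← mul_assoc]
      contMDiff_toFun := ?_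
      contMDiff_invFun := ?_ }, fun q ↦ ?_⟩
    · exact (f.contMDiff.comp contMDiff_fst).prodMk (hmul.comp
        (((contMDiff_circleExp (m := ∞)).comp (hfl.comp contMDiff_fst).neg).prodMk contMDiff_snd))
    · exact (f.symm.contMDiff.comp contMDiff_fst).prodMk (hmul.comp
        (((contMDiff_circleExp (m := ∞)).comp
          (hfl.comp (f.symm.contMDiff.comp contMDiff_fst))).prodMk contMDiff_snd))
    · rw [lift_eq, ← hf]
      rfl
  zero q := by simp [lift, hφ.zero]

/-- The pull-back of the product form under the lift. -/
theorem productForm_lift {η : OneForm I M} (hη : η.Smooth I) (Ω : TwoForm I M)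
    (hc : ∀ x (u v : TangentSpace I x), η.extDeriv I x u v = 0) {φ : ℝ → M → M}
    (hφ : IsIsotopy I φ) {t : ℝ} (ht : t ∈ Icc (0 : ℝ) 1) (x : M) (z : Circle)
    (u v : TangentSpace I x) (a b : TangentSpace (𝓡 1) z) :
    productForm I η Ω (lift I η φ t (x, z))
        (mfderiv (I.prod (𝓡 1)) (I.prod (𝓡 1)) (lift I η φ t) (x, z) (u, a))
        (mfderiv (I.prod (𝓡 1)) (I.prod (𝓡 1)) (lift I η φ t) (x, z) (v, b)) =
      Ω (φ t x) (mfderiv I I (φ t) x u) (mfderiv I I (φ t) x v) +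
        (η (φ t x) (mfderiv I I (φ t) x u) *
          (η x v - η (φ t x) (mfderiv I I (φ t) x v) + dTheta z b) -
        (η x u - η (φ t x) (mfderiv I I (φ t) x u) + dTheta z a) *
          η (φ t x) (mfderiv I I (φ t) x v)) := by
  have hL : MDifferentiableAt (I.prod (𝓡 1)) (I.prod (𝓡 1)) (lift I η φ t) (x, z) :=
    ((isIsotopy_lift hη hc hφ).contMDiff ht _).mdifferentiableAt (by simp)
  have hfst : ∀ (u : TangentSpace I x) (a : TangentSpace (𝓡 1) z),
      mfderiv (I.prod (𝓡 1)) I Prod.fst (lift I η φ t (x, z))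
        (mfderiv (I.prod (𝓡 1)) (I.prod (𝓡 1)) (lift I η φ t) (x, z) (u, a)) =
      mfderiv I I (φ t) x u := by
    intro u a
    have h1 := mfderiv_comp (x, z) (mdifferentiableAt_fst (x := lift I η φ t (x, z))) hL
    have h2 : mfderiv (I.prod (𝓡 1)) I (φ t ∘ Prod.fst) ((x, z) : M × Circle) = _ :=
      mfderiv_comp (x, z) ((hφ.contMDiff ht x).mdifferentiableAt (by simp))
        (mdifferentiableAt_fst (I := I) (I' := 𝓡 1) (x := (x, z)))
    rw [mfderiv_fst] at h2
    exact (congrArg (fun A ↦ A (u, a)) (h1.symm.trans h2))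
  have hsnd : ∀ (u : TangentSpace I x) (a : TangentSpace (𝓡 1) z),
      dTheta (lift I η φ t (x, z)).2
        (mfderiv (I.prod (𝓡 1)) (𝓡 1) Prod.snd (lift I η φ t (x, z))
        (mfderiv (I.prod (𝓡 1)) (I.prod (𝓡 1)) (lift I η φ t) (x, z) (u, a))) =
      η x u - η (φ t x) (mfderiv I I (φ t) x u) + dTheta z a := by
    intro u a
    have h1 := mfderiv_comp (x, z) (mdifferentiableAt_snd (x := lift I η φ t (x, z))) hL
    have hfl : MDifferentiableAt I 𝓘(ℝ, ℝ) (-flux I η φ t) x :=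
      ((contMDiff_flux hη hc hφ ht).neg x).mdifferentiableAt (by simp)
    have h2 := dTheta_mfderiv_exp_mul (I := I.prod (𝓡 1)) (x := (x, z)) (v := (u, a))
      (h := (-flux I η φ t) ∘ Prod.fst) (w := Prod.snd)
      (hfl.comp (x, z) mdifferentiableAt_fst) mdifferentiableAt_snd
    have h3 : mfderiv (I.prod (𝓡 1)) 𝓘(ℝ, ℝ) ((-flux I η φ t) ∘ Prod.fst) ((x, z) : M × Circle) = _ :=
      mfderiv_comp (x, z) hfl (mdifferentiableAt_fst (I := I) (I' := 𝓡 1) (x := (x, z)))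
    rw [mfderiv_fst, mfderiv_neg] at h3
    rw [mfderiv_snd, h3] at h2
    have h4 := mfderiv_flux hη hc hφ ht x u
    refine (congrArg (fun A ↦ dTheta _ (A (u, a))) h1).symm.trans (h2.trans ?_)
    refine congrArg (fun r : ℝ ↦ r + dTheta z a) ?_
    exact (congrArg (fun r : ℝ ↦ -r) h4).trans (neg_sub _ _)
  rw [productForm_apply, hfst, hfst, hsnd, hsnd]
  rfl

end ProductForm

section CriticalPoints

variable {E : Type*} [NormedAddCommGroup E] [NormedSpace ℝ E]
  {H : Type*} [TopologicalSpace H] {I : ModelWithCorners ℝ E H} [I.Boundaryless]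
  {M : Type*} [TopologicalSpace M] [ChartedSpace H M]

theorem mfderiv_eq_zero_of_isLocalMax {F : M → ℝ} {x : M} (hF : IsLocalMax F x) :
    mfderiv I 𝓘(ℝ, ℝ) F x = 0 := by
  by_cases hd : MDifferentiableAt I 𝓘(ℝ, ℝ) F x
  · have hmax : IsLocalMax (F ∘ (extChartAt I x).symm) (extChartAt I x x) := by
      have hF' : IsLocalMax F ((extChartAt I x).symm (extChartAt I x x)) := by
        rwa [extChartAt_to_inv]
      exact hF'.comp_continuous (continuousAt_extChartAt_symm x)
    rw [hd.mfderiv, I.range_eq_univ, fderivWithin_univ]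
    exact hmax.fderiv_eq_zero
  · exact mfderiv_zero_of_not_mdifferentiableAt hd

variable [IsManifold I ∞ M]

theorem isLocallyConstant_of_mfderiv_eq_zero {F : M → ℝ} (hF : ContMDiff I 𝓘(ℝ, ℝ) ∞ F)
    (h : ∀ x, mfderiv I 𝓘(ℝ, ℝ) F x = 0) : IsLocallyConstant F := by
  rw [IsLocallyConstant.iff_eventually_eq]
  intro x
  obtain ⟨r, hr, hball⟩ := Metric.isOpen_iff.1 (isOpen_extChartAt_target (I := I) x) _
    (mem_extChartAt_target (I := I) x)
  have hd : ∀ z ∈ Metric.ball (extChartAt I x x) r,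
      HasFDerivAt (F ∘ (extChartAt I x).symm) (0 : E →L[ℝ] ℝ) z := by
    intro z hz
    have h1 := ((hF _).mdifferentiableAt (by simp)).hasMFDerivAt.comp z
      ((contMDiffAt_extChartAt_symm_of_mem (I := I) (hball hz)).mdifferentiableAt
        (by simp)).hasMFDerivAt
    rw [h, ContinuousLinearMap.zero_comp] at h1
    exact h1.hasFDerivAt
  have hconst : ∀ z ∈ Metric.ball (extChartAt I x x) r,
      F ((extChartAt I x).symm z) = F ((extChartAt I x).symm (extChartAt I x x)) := fun z hz ↦
    Metric.isOpen_ball.is_const_of_fderiv_eq_zero (convex_ball _ r).isPreconnected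
      (fun z hz ↦ (hd z hz).differentiableAt.differentiableWithinAt)
      (fun z hz ↦ (hd z hz).fderiv) hz (Metric.mem_ball_self hr)
  filter_upwards [extChartAt_source_mem_nhds (I := I) x,
    (continuousAt_extChartAt (I := I) x) (Metric.ball_mem_nhds _ hr)] with y hy hyB
  have := hconst _ hyB
  rwa [(extChartAt I x).left_inv hy, extChartAt_to_inv] at this

end CriticalPoints

section Main

variable {E : Type*} [NormedAddCommGroup E] [NormedSpace ℝ E]
  {H : Type*} [TopologicalSpace H] {I : ModelWithCorners ℝ E H}
  {M : Type*} [TopologicalSpace M] [ChartedSpace H M] [IsManifold I ∞ M]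

theorem IsCoHamiltonianField.apply_eq_zero [I.Boundaryless] [CompactSpace M] {η : OneForm I M}
    {Ω : TwoForm I M} (hM : IsCosymplectic I η Ω) {X : VField I M}
    (hX : IsCoHamiltonianField I η Ω X) (x : M) : η x (X x) = 0 := by
  obtain ⟨F, hF, hXF⟩ := hX.exact
  have hsmooth : ContMDiff I 𝓘(ℝ, ℝ) ∞ (fun y ↦ η y (X y)) := fun y ↦ by
    have := hM.smooth_one.contMDiffWithinAt_apply (b := id) (V := X) (s := univ) (n₀ := y)
      (contMDiffWithinAt_univ.2 (hX.smooth y))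
    exact contMDiffWithinAt_univ.1 this
  have hconst : IsLocallyConstant (fun y ↦ η y (X y)) := by
    refine isLocallyConstant_of_mfderiv_eq_zero hsmooth fun y ↦ ?_
    ext u
    have h := hX.lie_one y u
    rw [OneForm.lieDeriv, hM.closed_one, zero_add] at h
    exact h
  set S : Set M := {y | η y (X y) = η x (X x)} with hS
  have hSc : IsCompact S := (hconst.isClosed_fiber (η x (X x))).isCompact
  obtain ⟨y, hy, hmax⟩ := hSc.exists_isMaxOn ⟨x, rfl⟩ hF.continuous.continuousOn
  have hloc : IsLocalMax F y :=
    hmax.isLocalMax ((hconst.isOpen_fiber (η x (X x))).mem_nhds hy)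
  have h0 : coIso I η Ω y (X y) = 0 :=
    (congrFun hXF y).trans (mfderiv_eq_zero_of_isLocalMax hloc)
  have hXy : X y = 0 := (hM.bijective y).1 (h0.trans (map_zero _).symm)
  have hy' : η y (X y) = η x (X x) := hy
  rw [← hy', hXy, map_zero]

omit [IsManifold I ∞ M] in
theorem lift_eq_of_speed_eq_zero {η : OneForm I M} {φ : ℝ → M → M}
    (h : ∀ s ∈ Icc (0 : ℝ) 1, ∀ x, speed I η φ s x = 0) {t : ℝ} (ht : t ∈ Icc (0 : ℝ) 1)
    (q : M × Circle) : lift I η φ t q = (φ t q.1, q.2) := by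
  have h0 : flux I η φ t q.1 = 0 := by
    rw [flux, intervalIntegral.integral_congr (g := fun _ ↦ (0 : ℝ))]
    · simp
    · intro s hs
      exact h s (ordConnected_Icc.uIcc_subset (by simp) ht hs) _
  rw [lift_eq, h0]
  simp

omit [IsManifold I ∞ M] in
theorem velocity_lift_of_speed_eq_zero {η : OneForm I M} {φ : ℝ → M → M} (hφ : IsIsotopy I φ)
    (h : ∀ s ∈ Icc (0 : ℝ) 1, ∀ x, speed I η φ s x = 0) {t : ℝ} (ht : t ∈ Icc (0 : ℝ) 1)
    (q : M × Circle) : velocity (I.prod (𝓡 1)) (lift I η φ) t q =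
      ((velocity I φ t q.1 : E), (0 : EuclideanSpace ℝ (Fin 1))) := by
  have h1 : mfderivWithin 𝓘(ℝ, ℝ) (I.prod (𝓡 1)) (fun s ↦ lift I η φ s q) (Icc 0 1) t =
      mfderivWithin 𝓘(ℝ, ℝ) (I.prod (𝓡 1)) (fun s ↦ (φ s q.1, q.2)) (Icc 0 1) t :=
    mfderivWithin_congr (fun s hs ↦ lift_eq_of_speed_eq_zero h hs q)
      (lift_eq_of_speed_eq_zero h ht q)
  have h2 := mfderivWithin_prodMk (I' := I) (I'' := 𝓡 1) (f := fun s ↦ φ s q.1)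
    (g := fun _ : ℝ ↦ q.2) ((hφ.contMDiffOn_trajectory q.1 t ht).mdifferentiableWithinAt (by simp))
    mdifferentiableWithinAt_const (uniqueMDiffOn_Icc_zero_one t ht)
  rw [mfderivWithin_const] at h2
  exact congrArg (fun A ↦ A (1 : ℝ)) (h1.trans h2)

variable [I.Boundaryless] [FiniteDimensional ℝ E]

theorem isSymplecticIsotopy_lift_iff {η : OneForm I M} {Ω : TwoForm I M}
    (hM : IsCosymplectic I η Ω) {φ : ℝ → M → M} (hφ : IsIsotopy I φ) :
    IsSymplecticIsotopy (I.prod (𝓡 1)) (productForm I η Ω) (lift I η φ) ↔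
      IsCosymplecticIsotopy I η Ω φ := by
  constructor
  · intro h
    have key : ∀ t ∈ Icc (0 : ℝ) 1, ∀ x (u v : TangentSpace I x)
        (a b : TangentSpace (𝓡 1) (1 : Circle)), _ := fun t ht x u v a b ↦
      (productForm_lift hM.smooth_one Ω hM.closed_one hφ ht x 1 u v a b).symm.trans
        ((h.preserves t ht (x, 1) (u, a) (v, b)).trans (productForm_pair η Ω x 1 u v a b))
    have h1 : ∀ t ∈ Icc (0 : ℝ) 1, η.PreservedBy I (φ t) := by
      intro t ht x u
      obtain ⟨b, hb⟩ := exists_dTheta_eq_one 1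
      have := key t ht x u 0 0 b
      simpa [hb] using this
    refine ⟨hφ, h1, fun t ht x u v ↦ ?_⟩
    have := key t ht x u v 0 0
    simpa [h1 t ht x] using this
  · intro h
    refine ⟨isIsotopy_lift hM.smooth_one hM.closed_one hφ, ?_⟩
    rintro t ht ⟨x, z⟩ ⟨u, a⟩ ⟨v, b⟩
    refine (productForm_lift hM.smooth_one Ω hM.closed_one hφ ht x z u v a b).trans
      (Eq.trans ?_ (productForm_pair η Ω x z u v a b).symm)
    rw [h.preserves_one t ht x u, h.preserves_one t ht x v, h.preserves_two t ht x u v]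
    simp

theorem isHamiltonianIsotopy_lift [CompactSpace M] {η : OneForm I M} {Ω : TwoForm I M}
    (hM : IsCosymplectic I η Ω) {φ : ℝ → M → M} (h : IsCoHamiltonianIsotopy I η Ω φ) :
    IsHamiltonianIsotopy (I.prod (𝓡 1)) (productForm I η Ω) (lift I η φ) := by
  have hφ := h.cosymplectic.isotopy
  have hspeed : ∀ s ∈ Icc (0 : ℝ) 1, ∀ x, speed I η φ s x = 0 := by
    intro s hs x
    obtain ⟨X, hgen, hX⟩ := h.hamiltonian s hs
    rw [speed, ← hgen x, hX.apply_eq_zero hM]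
  refine ⟨(isSymplecticIsotopy_lift_iff hM hφ).2 h.cosymplectic, fun t ht ↦ ?_⟩
  obtain ⟨X, hgen, hX⟩ := h.hamiltonian t ht
  obtain ⟨F, hF, hXF⟩ := hX.exact
  refine ⟨fun q ↦ ((X q.1 : E), (0 : EuclideanSpace ℝ (Fin 1))), fun q ↦ ?_, ?_, ?_⟩
  · refine Eq.trans ?_ (velocity_lift_of_speed_eq_zero hφ hspeed ht q).symm
    exact congrArg (fun v : E ↦ (v, (0 : EuclideanSpace ℝ (Fin 1)))) (hgen q.1)
  · have h1 : ContMDiff (I.prod (𝓡 1)) I.tangent ∞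
        (fun q : M × Circle ↦ (⟨q.1, X q.1⟩ : TangentBundle I M)) :=
      ContMDiff.comp (g := fun x ↦ (⟨x, X x⟩ : TangentBundle I M)) hX.smooth contMDiff_fst
    have h2 : ContMDiff (I.prod (𝓡 1)) (𝓡 1).tangent ∞
        (fun q : M × Circle ↦ (⟨q.2, 0⟩ : TangentBundle (𝓡 1) Circle)) :=
      ContMDiff.comp (g := fun z : Circle ↦ (⟨z, 0⟩ : TangentBundle (𝓡 1) Circle))
        (Bundle.contMDiff_zeroSection ℝ (TangentSpace (𝓡 1) : Circle → Type _)) contMDiff_snd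
    exact (contMDiff_equivTangentBundleProd_symm (n := ∞) (I := I) (I' := 𝓡 1)).comp (h1.prodMk h2)
  · refine ⟨F ∘ Prod.fst, hF.comp contMDiff_fst, ?_⟩
    funext ⟨x, z⟩
    ext ⟨v, b⟩
    have e1 := productForm_pair η Ω x z (X x) v 0 b
    have e2 : mfderiv (I.prod (𝓡 1)) 𝓘(ℝ, ℝ) (F ∘ Prod.fst) ((x, z) : M × Circle) = _ :=
      mfderiv_comp (x, z) ((hF x).mdifferentiableAt (by simp))
        (mdifferentiableAt_fst (I := I) (I' := 𝓡 1) (x := (x, z)))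
    rw [mfderiv_fst] at e2
    have e3 : coIso I η Ω x (X x) v = mfderiv I 𝓘(ℝ, ℝ) F x v :=
      congrArg (fun A ↦ A v) (congrFun hXF x)
    have e4 : coIso I η Ω x (X x) v = Ω x (X x) v + η x (X x) * η x v := rfl
    rw [hX.apply_eq_zero hM, zero_mul, add_zero] at e4
    rw [hX.apply_eq_zero hM, map_zero, zero_mul, zero_mul, sub_zero, add_zero] at e1
    exact e1.trans (e4.symm.trans (e3.trans (congrArg (fun A ↦ A (v, b)) e2).symm))

theorem isCoHamiltonianIsotopy_of_lift {η : OneForm I M} {Ω : TwoForm I M}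
    (hM : IsCosymplectic I η Ω) {φ : ℝ → M → M} (hφ : IsIsotopy I φ)
    (h : IsHamiltonianIsotopy (I.prod (𝓡 1)) (productForm I η Ω) (lift I η φ)) :
    IsCoHamiltonianIsotopy I η Ω φ := by
  have hlift : ∀ t (x : M) (z : Circle), ∃ w, lift I η φ t (x, w) = (φ t x, z) := fun t x z ↦
    ⟨Circle.exp (flux I η φ t x) * z, by rw [lift_eq]; simp [← mul_assoc]⟩
  have hfst : ∀ t ∈ Icc (0 : ℝ) 1, ∀ q : M × Circle,
      (show E × EuclideanSpace ℝ (Fin 1) from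
        velocity (I.prod (𝓡 1)) (lift I η φ) t q).1 = velocity I φ t q.1 := by
    intro t ht q
    have h1 := mfderiv_comp_mfderivWithin t
      (mdifferentiableAt_fst (I := I) (I' := 𝓡 1) (x := lift I η φ t q))
      ((h.symplectic.isotopy.contMDiffOn_trajectory q t ht).mdifferentiableWithinAt (by simp))
      (uniqueMDiffOn_Icc_zero_one t ht)
    rw [mfderiv_fst] at h1
    exact (congrArg (fun A ↦ A (1 : ℝ)) h1).symm
  have hXfst : ∀ t ∈ Icc (0 : ℝ) 1, ∀ X : VField (I.prod (𝓡 1)) (M × Circle),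
      IsGeneratorAt (I.prod (𝓡 1)) (lift I η φ) t X → ∀ x z,
      (show E × EuclideanSpace ℝ (Fin 1) from X (φ t x, z)).1 = velocity I φ t x := by
    intro t ht X hgen x z
    obtain ⟨w, hw⟩ := hlift t x z
    let Y : M × Circle → E := fun p ↦ (show E × EuclideanSpace ℝ (Fin 1) from X p).1
    have hY : Y (lift I η φ t (x, w)) = velocity I φ t x :=
      (congrArg (fun v : E × EuclideanSpace ℝ (Fin 1) ↦ v.1) (hgen (x, w))).trans (hfst t ht (x, w))
    rw [hw] at hY
    exact hY
  have hspeed : ∀ t ∈ Icc (0 : ℝ) 1, ∀ x, speed I η φ t x = 0 := by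
    intro t ht x
    obtain ⟨X, hgen, hX⟩ := h.hamiltonian t ht
    obtain ⟨F, hF, hXF⟩ := hX.exact
    have hFz : ContMDiff (𝓡 1) 𝓘(ℝ, ℝ) ∞ (fun z : Circle ↦ F (φ t x, z)) :=
      hF.comp (contMDiff_const.prodMk contMDiff_id)
    obtain ⟨z, -, hz⟩ := isCompact_univ.exists_isMaxOn ⟨(1 : Circle), mem_univ _⟩
      hFz.continuous.continuousOn
    have hcrit := mfderiv_eq_zero_of_isLocalMax (I := 𝓡 1) (hz.isLocalMax univ_mem)
    obtain ⟨b, hb⟩ := exists_dTheta_eq_one z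
    have e1 : mfderiv (𝓡 1) 𝓘(ℝ, ℝ) (fun z : Circle ↦ F (φ t x, z)) z = _ :=
      mfderiv_comp (g := F) (f := fun z : Circle ↦ (φ t x, z)) z
        ((hF _).mdifferentiableAt (by simp))
        (mdifferentiableAt_const.prodMk mdifferentiableAt_id)
    rw [mfderiv_prod_right, hcrit] at e1
    let V : E × EuclideanSpace ℝ (Fin 1) := X (φ t x, z)
    have e2 := productForm_pair η Ω (φ t x) z V.1 0 V.2 b
    have e3 : productForm I η Ω (φ t x, z) V ((0 : E), b) =
        mfderiv (I.prod (𝓡 1)) 𝓘(ℝ, ℝ) F (φ t x, z) ((0 : E), b) :=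
      congrArg (fun A ↦ A ((0 : E), b)) (congrFun hXF (φ t x, z))
    have e4 : (0 : ℝ) = mfderiv (I.prod (𝓡 1)) 𝓘(ℝ, ℝ) F (φ t x, z) ((0 : E), b) :=
      congrArg (fun A ↦ A b) e1
    rw [map_zero, map_zero, hb, mul_one, mul_zero, zero_add, sub_zero] at e2
    rw [speed, ← hXfst t ht X hgen x z]
    exact e2.symm.trans (e3.trans e4.symm)
  refine ⟨(isSymplecticIsotopy_lift_iff hM hφ).1 h.symplectic, fun t ht ↦ ?_⟩
  obtain ⟨X, hgen, hX⟩ := h.hamiltonian t ht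
  obtain ⟨F, hF, hXF⟩ := hX.exact
  obtain ⟨f, hf⟩ := hφ.diffeo t ht
  have hfsurj : ∀ y, ∃ x, φ t x = y := fun y ↦ ⟨f.symm y, by rw [← hf, f.apply_symm_apply]⟩
  let X' : VField I M := fun y ↦ (show E × EuclideanSpace ℝ (Fin 1) from X (y, 1)).1
  have hgen' : IsGeneratorAt I φ t X' := fun x ↦ hXfst t ht X hgen x 1
  have hη0 : ∀ y, η y (X' y) = 0 := by
    intro y
    obtain ⟨x, rfl⟩ := hfsurj y
    rw [hgen' x]
    exact hspeed t ht x
  have hXsnd : ∀ y, (show E × EuclideanSpace ℝ (Fin 1) from X (y, 1)).2 = 0 := by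
    intro y
    obtain ⟨x, rfl⟩ := hfsurj y
    let Y : M × Circle → EuclideanSpace ℝ (Fin 1) :=
      fun p ↦ (show E × EuclideanSpace ℝ (Fin 1) from X p).2
    have hY : Y (lift I η φ t (x, 1)) = 0 :=
      congrArg (fun v : E × EuclideanSpace ℝ (Fin 1) ↦ v.2)
        ((hgen (x, 1)).trans (velocity_lift_of_speed_eq_zero hφ hspeed ht (x, 1)))
    rw [lift_eq_of_speed_eq_zero hspeed ht] at hY
    exact hY
  have hexact : ContMDiff I 𝓘(ℝ, ℝ) ∞ (fun y ↦ F (y, 1)) ∧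
      ∀ y (v : TangentSpace I y), Ω y (X' y) v = differential I (fun y ↦ F (y, 1)) y v := by
    refine ⟨hF.comp (contMDiff_id.prodMk contMDiff_const), fun y v ↦ ?_⟩
    have e1 : mfderiv I 𝓘(ℝ, ℝ) (fun y : M ↦ F (y, 1)) y = _ :=
      mfderiv_comp (g := F) (f := fun y : M ↦ (y, (1 : Circle))) y
        ((hF _).mdifferentiableAt (by simp))
        (mdifferentiableAt_id.prodMk mdifferentiableAt_const)
    rw [mfderiv_prod_left] at e1
    let V : E × EuclideanSpace ℝ (Fin 1) := X (y, 1)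
    have hV : V.2 = 0 := hXsnd y
    have e2 := productForm_pair η Ω y 1 V.1 v V.2 0
    have e3 : productForm I η Ω (y, 1) V (v, (0 : EuclideanSpace ℝ (Fin 1))) =
        mfderiv (I.prod (𝓡 1)) 𝓘(ℝ, ℝ) F (y, 1) (v, (0 : EuclideanSpace ℝ (Fin 1))) :=
      congrArg (fun A ↦ A (v, (0 : EuclideanSpace ℝ (Fin 1)))) (congrFun hXF (y, 1))
    have e5 : dTheta 1 V.2 = 0 := (congrArg (dTheta 1) hV).trans (map_zero _)
    rw [e5, map_zero, mul_zero, zero_mul, sub_zero, add_zero] at e2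
    exact e2.symm.trans (e3.trans (congrArg (fun A ↦ A v) e1).symm)
  refine ⟨X', hgen', ⟨?_, fun y u ↦ ?_, fun y u v ↦ ?_, ⟨_, hexact.1, ?_⟩⟩⟩
  · have h1 : ContMDiff (I.prod (𝓡 1)).tangent I.tangent ∞
        (tangentMap (I.prod (𝓡 1)) I (Prod.fst : M × Circle → M)) :=
      contMDiff_fst.contMDiff_tangentMap (m := ∞) (n := ∞) (by simp)
    have h2 := h1.comp (ContMDiff.comp hX.smooth
      (contMDiff_id.prodMk contMDiff_const : ContMDiff I (I.prod (𝓡 1)) ∞ fun y : M ↦ (y, (1 : Circle))))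
    refine h2.congr fun y ↦ ?_
    simp only [Function.comp_apply, tangentMap_prodFst]
    rfl
  · rw [OneForm.lieDeriv, hM.closed_one, zero_add]
    have : (fun y ↦ η y (X' y)) = fun _ ↦ (0 : ℝ) := funext hη0
    rw [this, differential, mfderiv_const]
    rfl
  · rw [TwoForm.lieDeriv, hM.closed_two, zero_add]
    have : contract I X' Ω = differential I (fun y ↦ F (y, 1)) := by
      funext y
      ext v
      exact hexact.2 y v
    rw [this, extDeriv_differential hexact.1]
  · funext y
    ext v
    have e : coIso I η Ω y (X' y) v = Ω y (X' y) v + η y (X' y) * η y v := rfl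
    rw [hη0, zero_mul, add_zero] at e
    exact e.trans (hexact.2 y v)

end Main

end Cosymplectic

end

theorem mainTheorem3 {m : ℕ} {M : Type*} [TopologicalSpace M] [T2Space M] [CompactSpace M]
    [ChartedSpace (EuclideanSpace ℝ (Fin m)) M] [IsManifold (𝓡 m) ∞ M]
    (η : Cosymplectic.OneForm (𝓡 m) M) (Ω : Cosymplectic.TwoForm (𝓡 m) M)
    (hM : Cosymplectic.IsCosymplectic (𝓡 m) η Ω)
    (φ : ℝ → M → M) (hφ : Cosymplectic.IsIsotopy (𝓡 m) φ) :
    (Cosymplectic.IsCoHamiltonianIsotopy (𝓡 m) η Ω φ →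
      Cosymplectic.IsHamiltonianIsotopy ((𝓡 m).prod (𝓡 1))
        (Cosymplectic.productForm (𝓡 m) η Ω) (Cosymplectic.lift (𝓡 m) η φ)) ∧
    (Cosymplectic.IsCosymplecticIsotopy (𝓡 m) η Ω φ →
      Cosymplectic.IsSymplecticIsotopy ((𝓡 m).prod (𝓡 1))
        (Cosymplectic.productForm (𝓡 m) η Ω) (Cosymplectic.lift (𝓡 m) η φ)) ∧
    (Cosymplectic.IsHamiltonianIsotopy ((𝓡 m).prod (𝓡 1))
        (Cosymplectic.productForm (𝓡 m) η Ω) (Cosymplectic.lift (𝓡 m) η φ) →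
      Cosymplectic.IsCoHamiltonianIsotopy (𝓡 m) η Ω φ) ∧
    (Cosymplectic.IsSymplecticIsotopy ((𝓡 m).prod (𝓡 1))
        (Cosymplectic.productForm (𝓡 m) η Ω) (Cosymplectic.lift (𝓡 m) η φ) →
      Cosymplectic.IsCosymplecticIsotopy (𝓡 m) η Ω φ) :=
  ⟨Cosymplectic.isHamiltonianIsotopy_lift hM,
    (Cosymplectic.isSymplecticIsotopy_lift_iff hM hφ).2,
    Cosymplectic.isCoHamiltonianIsotopy_of_lift hM hφ,
    (Cosymplectic.isSymplecticIsotopy_lift_iff hM hφ).1⟩
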